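/- **Conventions.** For a Boolean algebra $B$, $\mathrm{Ult}(B)$ is the set of its ultrafilters (maximal proper filters), and a set $G\subseteq B$ is *generating* if the smallest Boolean subalgebra of $B$ containing $G$ is $B$. For a cardinal $\kappa$, $B$ is *$\kappa$-Corson* if there is a generating set $G\subseteq B$ with $|G\cap p|<\kappa$ for every $p\in\mathrm{Ult}(B)$. An infinite Boolean algebra $B$ has the *ultrafilter selection property* if for every generating set $G\subseteq B$ there is $p\in\mathrm{Ult}(B)$ with $|G\cap p|=|B|$. For a partially ordered set $P$, the *poset algebra* of $P$ is $\mathrm{Fr}(P)/I_P$, where $\mathrm{Fr}(P)$ is the free Boolean algebra over the set $P$ with free generators $x(p)$, $p\in P$, and $I_P$ is the ideal generated by $\{x(p)\cdot(-x(q)) : p\le q\}$; a *poset Boolean algebra* is a Boolean algebra isomorphic to the poset algebra of some partially ordered set. The *interval algebra* of a linearly ordered set $C$ is the subalgebra of the power set of $C$ generated by the rays $\{x\in C: x\ge a\}$, $a\in C$. **Theorem.** Let $B$ be a poset Boolean algebra. 1. Let $\kappa$ be a regular uncountable cardinal with $|B|\ge\kappa$. Then for every generating set $G\subseteq B$ there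 is an ultrafilter $p\in\mathrm{Ult}(B)$ with $|G\cap p|\ge\kappa$; thus $B$ is not $\kappa$-Corson. 2. In particular, if $|B|$ is a regular uncountable cardinal, then $B$ has the ultrafilter selection property, i.e. for every generating set $G\subseteq B$ there is $p\in\mathrm{Ult}(B)$ with $|G\cap p|=|B|$; thus $B$ is not $|B|$-Corson. 3. The interval algebra of every nonempty linearly ordered set is a poset Boolean algebra; in particular, every interval algebra of regular uncountable cardinality has the ultrafilter selection property. -/

import Mathlib

open Cardinal

universe u

/-- The free Boolean algebra `Fr(X)` over a set `X`: the algebra of clopen subsets of `2 ^ X`,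
that is, the subalgebra of the power set of `2 ^ X = Set X` generated by the subbasic sets
`{S | x ∈ S}`, `x ∈ X`. -/
abbrev FreeBoolAlg (X : Type u) : Type u :=
  BooleanSubalgebra.closure (Set.range fun x : X => {S : Set X | x ∈ S})

namespace FreeBoolAlg

/-- The canonical embedding of `X` into the free Boolean algebra over `X`. -/
def of {X : Type u} (x : X) : FreeBoolAlg X :=
  ⟨{S : Set X | x ∈ S}, BooleanSubalgebra.subset_closure ⟨x, rfl⟩⟩

end FreeBoolAlg

/-- The ideal `I_P` of `Fr(P)` generated by the elements `x(p) - x(q)` with `p ≤ q`. Ideals of a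
Boolean algebra are the same sets as ideals of the associated Boolean ring (with symmetric
difference as addition and meet as multiplication). -/
def posetIdeal (P : Type u) [PartialOrder P] : Ideal (AsBoolRing (FreeBoolAlg P)) :=
  Ideal.span {a | ∃ p q : P, p ≤ q ∧ a = toBoolRing (FreeBoolAlg.of p \ FreeBoolAlg.of q)}

/-- The quotient of a Boolean ring by an ideal is a Boolean ring. -/
instance BooleanRing.instQuotientIdeal {R : Type u} [BooleanRing R] (I : Ideal R) :
    BooleanRing (R ⧸ I) where
  isIdempotentElem := by
    intro a
    obtain ⟨r, rfl⟩ := Ideal.Quotient.mk_surjective a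
    exact (BooleanRing.isIdempotentElem r).map (Ideal.Quotient.mk I)

/-- The poset algebra `B(P) = Fr(P) / I_P`. -/
abbrev PosetAlgebra (P : Type u) [PartialOrder P] : Type u :=
  AsBoolAlg (AsBoolRing (FreeBoolAlg P) ⧸ posetIdeal P)

/-- `B` is a poset Boolean algebra: it is isomorphic to `B(P)` for some poset `P`. -/
def IsPosetAlgebra (B : Type u) [BooleanAlgebra B] : Prop :=
  ∃ (P : Type u) (_ : PartialOrder P), Nonempty (B ≃o PosetAlgebra P)

/-- The interval algebra of a chain `C`: the subalgebra of the power set of `C` generated by the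
final rays `[a, →)`, `a ∈ C`. -/
abbrev IntervalAlgebra (C : Type u) [LinearOrder C] : Type u :=
  BooleanSubalgebra.closure (Set.range fun a : C => Set.Ici a)

section Ultrafilters

variable (B : Type u) [BooleanAlgebra B]

/-- `Ult(B)`: the ultrafilters of `B`, i.e. the maximal proper filters. -/
def Ult : Set (Order.PFilter B) := {p | IsCoatom p}

variable {B}

/-- `G` generates `B` as a Boolean algebra. -/
def GeneratesBA (G : Set B) : Prop := BooleanSubalgebra.closure G = ⊤

variable (B)

/-- `B` is `κ`-Corson: some generating set meets every ultrafilter in fewer than `κ` elements. -/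
def IsCorsonBA (κ : Cardinal.{u}) : Prop :=
  ∃ G : Set B, GeneratesBA G ∧ ∀ p ∈ Ult B, #(G ∩ (p : Set B) : Set B) < κ

/-- The ultrafilter selection property of an (infinite) Boolean algebra `B`: for every generating
set `G` there is an ultrafilter containing `|B|` many elements of `G`. -/
def UltrafilterSelectionProperty : Prop :=
  Infinite B ∧ ∀ G : Set B, GeneratesBA G → ∃ p ∈ Ult B, #(G ∩ (p : Set B) : Set B) = #B

end Ultrafilters

/-! A poset algebra is generated by a copy of `P`, and every upper set of `P` gives an ultrafilter.
Suppose each ultrafilter meets `G` in fewer than `κ` elements. Closing off yields a lattice `L` of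
fewer than `κ` upper sets such that, whenever `g ∈ G` holds at a member of `L`, both `Ici p` and
`(Iic p)ᶜ` are in `L` for all `p` in a finite support of `g`. By cardinality `Ici q ∉ L` for some
`q`. Let `a` be the intersection of the members of `L` containing `q`, and `b` the union of those
omitting it. Since `q ∈ a \ b`, some `g ∈ G` separates `a` from `a ∩ b`. Finiteness of supports
makes `g` hold at a member of `L`, so some `p ∈ a \ b` has `Ici p` and `(Iic p)ᶜ` in `L`. This
forces `p = q`, a contradiction (`exists_ult_le_mk_inter`).

An interval algebra is the poset algebra of the reversed chain of nonminimal points, because on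
finite sets initial segments look principal (`exists_forall_mem_iff_le`). -/

/-- For a regular uncountable `κ`, every set of size `< κ` is contained in a set of size `< κ`
closed under a given binary operation with values in sets of size `< κ`. -/
theorem Cardinal.IsRegular.exists_closed_superset {T : Type u} {κ : Cardinal.{u}}
    (hκ : κ.IsRegular) (hκ' : ℵ₀ < κ) (F : T → T → Set T) (hF : ∀ x y, #(F x y) < κ)
    (S₀ : Set T) (hS₀ : #S₀ < κ) :
    ∃ S : Set T, S₀ ⊆ S ∧ #S < κ ∧ ∀ x ∈ S, ∀ y ∈ S, F x y ⊆ S := by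
  let step : Set T → Set T := fun A => A ∪ ⋃ x ∈ A, ⋃ y ∈ A, F x y
  let A : ℕ → Set T := fun n => step^[n] S₀
  have hsucc (n : ℕ) : A (n + 1) = step (A n) := Function.iterate_succ_apply' ..
  have hmono : Monotone A := monotone_nat_of_le_succ fun n => by
    rw [hsucc]; exact Set.subset_union_left
  have hcard (n : ℕ) : #(A n) < κ := by
    induction n with
    | zero => exact hS₀
    | succ n ih =>
      rw [hsucc]
      refine (mk_union_le _ _).trans_lt (add_lt_of_lt hκ.aleph0_le ih ?_)
      rw [card_biUnion_lt_iff_forall_of_isRegular hκ ih]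
      intro x _
      rw [card_biUnion_lt_iff_forall_of_isRegular hκ ih]
      exact fun y _ => hF x y
  -- A countable union of sets of size `< κ` stays below `κ`, as `κ` is regular and uncountable.
  refine ⟨⋃ n : ULift.{u} ℕ, A n.down, Set.subset_iUnion_of_subset ⟨0⟩ subset_rfl, ?_, ?_⟩
  · rw [card_iUnion_lt_iff_forall_of_isRegular hκ (by simpa using hκ')]
    exact fun n => hcard _
  · intro x hx y hy
    obtain ⟨⟨m⟩, hm⟩ := Set.mem_iUnion.1 hx
    obtain ⟨⟨n⟩, hn⟩ := Set.mem_iUnion.1 hy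
    refine Set.subset_iUnion_of_subset ⟨max m n + 1⟩ ?_
    rw [hsucc]
    intro z hz
    refine Or.inr (Set.mem_iUnion₂.2 ⟨x, hmono (le_max_left _ _) hm, ?_⟩)
    exact Set.mem_iUnion₂.2 ⟨y, hmono (le_max_right _ _) hn, hz⟩

/-! ### Generating sets and two-valued homomorphisms -/

section Generators

variable {A B : Type u} [BooleanAlgebra A] [BooleanAlgebra B]

theorem GeneratesBA.induction {G : Set B} (hG : GeneratesBA G) {C : B → Prop}
    (mem : ∀ x ∈ G, C x) (bot : C ⊥) (sup : ∀ x y, C x → C y → C (x ⊔ y))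
    (compl : ∀ x, C x → C xᶜ) (b : B) : C b := by
  have hb : b ∈ BooleanSubalgebra.closure G := by
    rw [show BooleanSubalgebra.closure G = ⊤ from hG]; trivial
  exact BooleanSubalgebra.closure_bot_sup_induction (p := fun x _ => C x) mem bot
    (fun x _ y _ => sup x y) (fun x _ => compl x) hb

theorem generatesBA_closure (s : Set B) :
    GeneratesBA {b : BooleanSubalgebra.closure s | (b : B) ∈ s} := by
  refine eq_top_iff.2 fun b _ => ?_
  obtain ⟨b, hb⟩ := b
  induction hb using BooleanSubalgebra.closure_bot_sup_induction with
  | mem x hx => exact BooleanSubalgebra.subset_closure hx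
  | bot => exact BooleanSubalgebra.bot_mem
  | sup x _ y _ hx hy => exact BooleanSubalgebra.sup_mem (hx trivial) (hy trivial)
  | compl x _ hx => exact BooleanSubalgebra.compl_mem (hx trivial)

theorem GeneratesBA.image {G : Set A} (hG : GeneratesBA G) (f : BoundedLatticeHom A B)
    (hf : Function.Surjective f) : GeneratesBA (f '' G) := by
  refine eq_top_iff.2 fun b _ => ?_
  obtain ⟨a, rfl⟩ := hf b
  refine hG.induction (C := fun a => f a ∈ BooleanSubalgebra.closure (f '' G))
    (fun x hx => BooleanSubalgebra.subset_closure ⟨x, hx, rfl⟩) ?_ ?_ ?_ a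
  · rw [map_bot]; exact BooleanSubalgebra.bot_mem
  · intro x y hx hy
    rw [map_sup]; exact BooleanSubalgebra.sup_mem hx hy
  · intro x hx
    rw [map_compl']; exact BooleanSubalgebra.compl_mem hx

/-- A Boolean algebra of size at least a regular uncountable `κ` has no generating set of size
`< κ`. -/
theorem GeneratesBA.le_mk {G : Set B} (hG : GeneratesBA G) {κ : Cardinal.{u}}
    (hκ : κ.IsRegular) (hκ' : ℵ₀ < κ) (hB : κ ≤ #B) : κ ≤ #G := by
  by_contra! h
  obtain ⟨S, hGS, hS, hcl⟩ := hκ.exists_closed_superset hκ' (fun x y : B => {x ⊔ y, xᶜ})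
    (fun x y => (Set.toFinite _).lt_aleph0.trans hκ') (insert ⊥ G)
    ((mk_insert_le).trans_lt (add_lt_of_lt hκ.aleph0_le h (one_lt_aleph0.trans hκ')))
  have hall : ∀ b, b ∈ S := hG.induction (fun x hx => hGS (Or.inr hx)) (hGS (Or.inl rfl))
    (fun x y hx hy => hcl x hx y hy (by simp)) (fun x hx => hcl x hx x hx (by simp))
  rw [Set.eq_univ_of_forall hall, mk_univ] at hS
  exact hS.not_ge hB

/-- The value of a two-valued homomorphism at `b` depends only on its values at finitely many
generators. -/
theorem GeneratesBA.exists_finset {P : Type u} {e : P → B} (he : GeneratesBA (Set.range e))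
    (b : B) : ∃ F : Finset P, ∀ h k : BoundedLatticeHom B Prop,
      (∀ p ∈ F, h (e p) ↔ k (e p)) → (h b ↔ k b) := by
  classical
  refine he.induction (C := fun b => ∃ F : Finset P, ∀ h k : BoundedLatticeHom B Prop,
      (∀ p ∈ F, h (e p) ↔ k (e p)) → (h b ↔ k b)) ?_ ?_ ?_ ?_ b
  · rintro _ ⟨p, rfl⟩
    exact ⟨{p}, fun h k H => H p (by simp)⟩
  · exact ⟨∅, fun h k _ => by simp⟩
  · rintro x y ⟨F, hF⟩ ⟨F', hF'⟩
    refine ⟨F ∪ F', fun h k H => ?_⟩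
    rw [map_sup, map_sup]
    exact or_congr (hF h k fun p hp => H p (Finset.mem_union_left _ hp))
      (hF' h k fun p hp => H p (Finset.mem_union_right _ hp))
  · rintro x ⟨F, hF⟩
    refine ⟨F, fun h k H => ?_⟩
    rw [map_compl', map_compl']
    exact not_congr (hF h k H)

theorem GeneratesBA.hom_ext {G : Set B} (hG : GeneratesBA G) {h k : BoundedLatticeHom B Prop}
    (H : ∀ g ∈ G, h g ↔ k g) (b : B) : h b ↔ k b := by
  obtain ⟨F, hF⟩ := GeneratesBA.exists_finset (e := ((↑) : G → B))
    (by rwa [Subtype.range_coe]) b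
  exact hF h k fun p _ => H p p.2

/-- Two-valued homomorphisms are ultrafilters. -/
theorem exists_ult_of_hom (h : BoundedLatticeHom B Prop) :
    ∃ p ∈ Ult B, ∀ b, b ∈ p ↔ h b := by
  have hF : Order.IsPFilter {b | h b} := by
    refine .of_def ⟨⊤, ?_⟩ ?_ ?_
    · simp
    · intro x hx y hy
      exact ⟨x ⊓ y, by simpa using ⟨hx, hy⟩, inf_le_left, inf_le_right⟩
    · intro x y hxy hx
      exact (OrderHomClass.mono h hxy) hx
  have hmem (b : B) : b ∈ hF.toPFilter ↔ h b := Iff.rfl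
  refine ⟨hF.toPFilter, ⟨?_, ?_⟩, hmem⟩
  · intro htop
    have : (⊥ : B) ∈ hF.toPFilter := by rw [htop]; trivial
    rw [hmem, map_bot] at this
    exact this
  · intro q hq
    obtain ⟨hle, b, hbq, hb⟩ := SetLike.lt_iff_le_and_exists.1 hq
    have hb' : bᶜ ∈ q := hle (by rw [hmem, map_compl']; exact hb)
    have hbot : (⊥ : B) ∈ q := by
      obtain ⟨z, hz, hzb, hzb'⟩ := q.directed b hbq bᶜ hb'
      exact q.mem_of_le (le_of_le_of_eq (le_inf hzb hzb') (inf_compl_self b)) hz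
    exact eq_top_iff.2 fun x _ => q.mem_of_le bot_le hbot

end Generators

/-! ### The closing-off argument -/

/-- If `B` is generated by the image of `P` and every upper set of `P` is cut out by a two-valued
homomorphism of `B`, then for every generating set of `B` some ultrafilter contains at least `κ` of
its elements. -/
theorem exists_ult_le_mk_inter {P B : Type u} [PartialOrder P] [BooleanAlgebra B] {e : P → B}
    (he : GeneratesBA (Set.range e)) (φ : Set P → BoundedLatticeHom B Prop)
    (hφ : ∀ x, IsUpperSet x → ∀ p, φ x (e p) ↔ p ∈ x)
    {κ : Cardinal.{u}} (hκ : κ.IsRegular) (hκ' : ℵ₀ < κ) (hB : κ ≤ #B)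
    {G : Set B} (hG : GeneratesBA G) : ∃ p ∈ Ult B, κ ≤ #(G ∩ (p : Set B) : Set B) := by
  classical
  by_contra! hcon
  let supp : Set P → Set B := fun x => {g ∈ G | φ x g}
  have hsupp (x : Set P) : #(supp x) < κ := by
    obtain ⟨p, hp, hpx⟩ := exists_ult_of_hom (φ x)
    convert hcon p hp using 3
    ext g
    exact and_congr_right fun _ => (hpx g).symm
  choose D hD using fun b => he.exists_finset b
  have hDφ {x y : Set P} (hx : IsUpperSet x) (hy : IsUpperSet y) (b : B)
      (H : ∀ p ∈ D b, p ∈ x ↔ p ∈ y) : φ x b ↔ φ y b :=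
    hD b _ _ fun p hp => by rw [hφ x hx, hφ y hy]; exact H p hp
  -- The lattice operations serve finite approximation; the two sets attached to `p` will compare
  -- `p` with `q`.
  let F : Set P → Set P → Set (Set P) := fun x y =>
    {x ∩ y, x ∪ y} ∪ ⋃ g ∈ supp x, ⋃ p ∈ (D g : Set P), {Set.Ici p, (Set.Iic p)ᶜ}
  have hF (x y : Set P) : #(F x y) < κ := by
    refine (mk_union_le _ _).trans_lt (add_lt_of_lt hκ.aleph0_le
      ((Set.toFinite _).lt_aleph0.trans hκ') ?_)
    rw [card_biUnion_lt_iff_forall_of_isRegular hκ (hsupp x)]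
    exact fun g _ => (((D g).finite_toSet.biUnion fun _ _ => Set.toFinite _).lt_aleph0).trans hκ'
  obtain ⟨S, hS₀, hS, hcl⟩ := hκ.exists_closed_superset hκ' F hF {∅, Set.univ}
    ((Set.toFinite _).lt_aleph0.trans hκ')
  -- the sublattice of upper sets in `S`
  let L : Set (Set P) := {x ∈ S | IsUpperSet x}
  have hbot : ∅ ∈ L := ⟨hS₀ (by simp), isUpperSet_empty⟩
  have htop : Set.univ ∈ L := ⟨hS₀ (by simp), isUpperSet_univ⟩
  have hinter {x y} (hx : x ∈ L) (hy : y ∈ L) : x ∩ y ∈ L :=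
    ⟨hcl x hx.1 y hy.1 (Or.inl (by simp)), hx.2.inter hy.2⟩
  have hunion {x y} (hx : x ∈ L) (hy : y ∈ L) : x ∪ y ∈ L :=
    ⟨hcl x hx.1 y hy.1 (Or.inl (by simp)), hx.2.union hy.2⟩
  have hray {x g p} (hx : x ∈ L) (hg : g ∈ supp x) (hp : p ∈ D g) :
      Set.Ici p ∈ L ∧ (Set.Iic p)ᶜ ∈ L := by
    have h : ({Set.Ici p, (Set.Iic p)ᶜ} : Set (Set P)) ⊆ S := fun z hz =>
      hcl x hx.1 x hx.1 (Or.inr (Set.mem_iUnion₂.2 ⟨g, hg, Set.mem_iUnion₂.2 ⟨p, hp, hz⟩⟩))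
    exact ⟨⟨h (by simp), isUpperSet_Ici p⟩, ⟨h (by simp), (isLowerSet_Iic p).compl⟩⟩
  -- Otherwise `P` embeds into `S`; but `P` indexes a generating set, so it has size at least `κ`.
  obtain ⟨q, hq⟩ : ∃ q, Set.Ici q ∉ L := by
    by_contra! hall
    have h₁ : #P ≤ #S := mk_le_of_injective (f := fun q => (⟨Set.Ici q, (hall q).1⟩ : S))
      fun p q hpq => Set.Ici_injective (congrArg Subtype.val hpq)
    exact ((he.le_mk hκ hκ' hB).trans mk_range_le).not_gt (h₁.trans_lt hS)
  -- These need not lie in `L`, but on each finite set they agree with members of `L`, by closure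
  -- under finite meets and joins.
  let a : Set P := ⋂₀ {x ∈ L | q ∈ x}
  let b : Set P := ⋃₀ {x ∈ L | q ∉ x}
  have hqa : q ∈ a := fun x hx => hx.2
  have hqb : q ∉ b := fun ⟨x, hx, hqx⟩ => hx.2 hqx
  have ha : IsUpperSet a := isUpperSet_sInter fun x hx => hx.1.2
  have hb : IsUpperSet b := isUpperSet_sUnion fun x hx => hx.1.2
  have happrox_a (E : Finset P) : ∃ x ∈ L, q ∈ x ∧ ∀ p ∈ E, p ∈ x ↔ p ∈ a := by
    suffices ∃ x ∈ L, q ∈ x ∧ ∀ p ∈ E, p ∈ x → p ∈ a by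
      obtain ⟨x, hx, hqx, H⟩ := this
      exact ⟨x, hx, hqx, fun p hp => ⟨H p hp, fun h => h x ⟨hx, hqx⟩⟩⟩
    induction E using Finset.induction_on with
    | empty => exact ⟨_, htop, trivial, by simp⟩
    | insert r E _ ih =>
      obtain ⟨x, hx, hqx, H⟩ := ih
      by_cases hr : r ∈ a
      · exact ⟨x, hx, hqx, by simpa [hr] using H⟩
      · obtain ⟨y, hy, hry⟩ : ∃ y, (y ∈ L ∧ q ∈ y) ∧ r ∉ y := by simpa [a, and_assoc] using hr
        refine ⟨x ∩ y, hinter hx hy.1, ⟨hqx, hy.2⟩, fun p hp hpx => ?_⟩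
        rcases Finset.mem_insert.1 hp with rfl | hp
        exacts [(hry hpx.2).elim, H p hp hpx.1]
  have happrox_b (E : Finset P) : ∃ x ∈ L, q ∉ x ∧ ∀ p ∈ E, p ∈ x ↔ p ∈ b := by
    suffices ∃ x ∈ L, q ∉ x ∧ ∀ p ∈ E, p ∈ b → p ∈ x by
      obtain ⟨x, hx, hqx, H⟩ := this
      exact ⟨x, hx, hqx, fun p hp => ⟨fun h => ⟨x, ⟨hx, hqx⟩, h⟩, H p hp⟩⟩
    induction E using Finset.induction_on with
    | empty => exact ⟨_, hbot, id, by simp⟩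
    | insert r E _ ih =>
      obtain ⟨x, hx, hqx, H⟩ := ih
      by_cases hr : r ∈ b
      · obtain ⟨y, hy, hry⟩ := hr
        refine ⟨x ∪ y, hunion hx hy.1, fun h => h.elim hqx hy.2, fun p hp hpx => ?_⟩
        rcases Finset.mem_insert.1 hp with rfl | hp
        exacts [Or.inr hry, Or.inl (H p hp hpx)]
      · exact ⟨x, hx, hqx, by simpa [hr] using H⟩
  -- `a` and `a ∩ b` are separated by some `g ∈ G`
  obtain ⟨g, hg, hne⟩ : ∃ g ∈ G, ¬(φ a g ↔ φ (a ∩ b) g) := by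
    by_contra! H
    have := hG.hom_ext H (e q)
    rw [hφ a ha, hφ _ (ha.inter hb)] at this
    exact hqb (this.1 hqa).2
  obtain ⟨x, hx, -, hxa⟩ := happrox_a (D g)
  obtain ⟨y, hy, -, hyb⟩ := happrox_b (D g)
  have hxg : φ x g ↔ φ a g := hDφ hx.2 ha g hxa
  have hyg : φ (x ∩ y) g ↔ φ (a ∩ b) g := hDφ (hx.2.inter hy.2) (ha.inter hb) g fun p hp =>
    and_congr (hxa p hp) (hyb p hp)
  -- As `g` separates `a` from `a ∩ b`, it holds at one of them, hence at `x` or at `x ∩ y`, both in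
  -- `L`.
  have hrays (p) (hp : p ∈ D g) : Set.Ici p ∈ L ∧ (Set.Iic p)ᶜ ∈ L := by
    by_cases h : φ a g
    · exact hray hx ⟨hg, hxg.2 h⟩ hp
    · exact hray (hinter hx hy) ⟨hg, hyg.2 (by tauto)⟩ hp
  obtain ⟨p, hp, hpa, hpb⟩ : ∃ p ∈ D g, p ∈ a ∧ p ∉ b := by
    by_contra! H
    exact hne (hDφ ha (ha.inter hb) g fun p hp => ⟨fun h => ⟨h, H p hp h⟩, And.left⟩)
  obtain ⟨h₁, h₂⟩ := hrays p hp
  -- If `q ∉ Ici p`, then `Ici p ⊆ b`; if `q ∈ (Iic p)ᶜ`, then `a ⊆ (Iic p)ᶜ`. Both contradict `p ∈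
  -- a \ b`.
  have hpq : p ≤ q := by
    by_contra h
    exact hpb ⟨_, ⟨h₁, h⟩, le_rfl⟩
  have hqp : q ≤ p := by
    by_contra h
    exact hpa _ ⟨h₂, h⟩ le_rfl
  exact hq (le_antisymm hpq hqp ▸ h₁)

/-! ### Free algebras, poset algebras and their points -/

theorem FreeBoolAlg.generatesBA_range_of (X : Type u) :
    GeneratesBA (Set.range (FreeBoolAlg.of : X → FreeBoolAlg X)) := by
  convert generatesBA_closure (Set.range fun x : X => {S : Set X | x ∈ S}) using 1
  ext b
  exact exists_congr fun x => Subtype.ext_iff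

/-- The two-valued homomorphism on the free Boolean algebra given by a point of `2 ^ X`. -/
def FreeBoolAlg.eval {X : Type u} (x : Set X) : BoundedLatticeHom (FreeBoolAlg X) Prop where
  toFun t := x ∈ t.1
  map_sup' _ _ := rfl
  map_inf' _ _ := rfl
  map_top' := rfl
  map_bot' := rfl

/-- A prime ideal as a two-valued homomorphism. -/
def Ideal.IsPrime.hom {A : Type u} [BooleanAlgebra A] {m : Ideal (AsBoolRing A)}
    (hm : m.IsPrime) : BoundedLatticeHom A Prop :=
  have hinf (a b : A) : toBoolRing (a ⊓ b) ∈ m ↔ toBoolRing a ∈ m ∨ toBoolRing b ∈ m :=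
    hm.mul_mem_iff_mem_or_mem
  { toFun a := toBoolRing a ∉ m
    map_inf' a b := by
      exact propext ((not_congr (hinf a b)).trans not_or)
    map_sup' a b := by
      refine propext (Iff.trans (not_congr (b := toBoolRing a ∈ m ∧ toBoolRing b ∈ m) ?_)
        not_and_or)
      constructor
      · intro h
        have ha := (hinf (a ⊔ b) a).2 (Or.inl h)
        have hb := (hinf (a ⊔ b) b).2 (Or.inl h)
        rw [inf_eq_right.2 le_sup_left] at ha
        rw [inf_eq_right.2 le_sup_right] at hb
        exact ⟨ha, hb⟩
      · rintro ⟨ha, hb⟩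
        -- In a Boolean ring the join is `a + b + a * b`.
        have h := m.add_mem (m.add_mem ha hb) (m.mul_mem_left (toBoolRing a) hb)
        rw [← toBoolRing_inf, ← toBoolRing_symmDiff, ← toBoolRing_symmDiff,
          symmDiff_symmDiff_inf] at h
        exact h
    map_top' := by
      simpa using m.ne_top_iff_one.1 hm.ne_top
    map_bot' := by simp }

namespace PosetAlgebra

variable {P : Type u} [PartialOrder P] {B : Type*} [BooleanAlgebra B]

/-- The canonical projection from the free Boolean algebra over `P`. -/
def mk (P : Type u) [PartialOrder P] : BoundedLatticeHom (FreeBoolAlg P) (PosetAlgebra P) :=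
  (Ideal.Quotient.mk (posetIdeal P)).asBoolAlg.comp
    ((OrderIso.asBoolAlgAsBoolRing (FreeBoolAlg P)).symm : BoundedLatticeHom _ _)

theorem mk_surjective : Function.Surjective (mk P) :=
  fun b => Ideal.Quotient.mk_surjective (ofBoolAlg b)

theorem mk_eq_bot_iff {t : FreeBoolAlg P} : mk P t = ⊥ ↔ toBoolRing t ∈ posetIdeal P :=
  Ideal.Quotient.eq_zero_iff_mem

theorem posetIdeal_le_ker {f : BoundedLatticeHom (FreeBoolAlg P) B}
    (hf : ∀ p q, p ≤ q → f (FreeBoolAlg.of p) ≤ f (FreeBoolAlg.of q)) :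
    posetIdeal P ≤ RingHom.ker f.asBoolRing := by
  refine Ideal.span_le.2 ?_
  rintro _ ⟨p, q, hpq, rfl⟩
  change f (_ \ _) = ⊥
  rw [map_sdiff']
  exact sdiff_eq_bot_iff.2 (hf p q hpq)

/-- The universal property of the poset algebra with respect to homomorphisms defined on the free
Boolean algebra. -/
def lift (f : BoundedLatticeHom (FreeBoolAlg P) B)
    (hf : ∀ p q, p ≤ q → f (FreeBoolAlg.of p) ≤ f (FreeBoolAlg.of q)) :
    BoundedLatticeHom (PosetAlgebra P) B :=
  ((OrderIso.asBoolAlgAsBoolRing B : BoundedLatticeHom _ _)).comp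
    (Ideal.Quotient.lift (posetIdeal P) f.asBoolRing fun _ ha => posetIdeal_le_ker hf ha).asBoolAlg

@[simp]
theorem lift_mk (f : BoundedLatticeHom (FreeBoolAlg P) B)
    (hf : ∀ p q, p ≤ q → f (FreeBoolAlg.of p) ≤ f (FreeBoolAlg.of q)) (t : FreeBoolAlg P) :
    lift f hf (mk P t) = f t := rfl

/-- An element of the free Boolean algebra containing no upper set vanishes in the poset
algebra. -/
theorem mk_eq_bot {t : FreeBoolAlg P} (ht : ∀ x : Set P, IsUpperSet x → x ∉ t.1) :
    mk P t = ⊥ := by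
  rw [mk_eq_bot_iff]
  by_contra h
  -- A prime ideal missing `t` is evaluation at a point `x` of `2 ^ P`; since it contains `I_P`, `x`
  -- is an upper set.
  obtain ⟨m, hm, hle, hmt⟩ := Ideal.exists_le_prime_notMem_of_isIdempotentElem (posetIdeal P)
    (toBoolRing t) (BooleanRing.isIdempotentElem _) h
  let x : Set P := {p | hm.hom (FreeBoolAlg.of p)}
  have hx (s : FreeBoolAlg P) : hm.hom s ↔ FreeBoolAlg.eval x s :=
    (FreeBoolAlg.generatesBA_range_of P).hom_ext (by rintro _ ⟨p, rfl⟩; rfl) s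
  refine ht x ?_ ((hx t).1 hmt)
  intro p q hpq hp
  by_contra hq
  have hmem : ¬ hm.hom (FreeBoolAlg.of p \ FreeBoolAlg.of q) :=
    not_not.2 (hle (Ideal.subset_span ⟨p, q, hpq, rfl⟩))
  rw [map_sdiff'] at hmem
  exact hmem ⟨hp, hq⟩

end PosetAlgebra

/-- A homomorphism of Boolean algebras that is onto and has trivial kernel is an isomorphism. -/
noncomputable def BoundedLatticeHom.orderIsoOfSurjective {A B : Type u} [BooleanAlgebra A]
    [BooleanAlgebra B] (f : BoundedLatticeHom A B) (hf : Function.Surjective f)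
    (hker : ∀ a, f a = ⊥ → a = ⊥) : A ≃o B :=
  have hle {a b : A} : f a ≤ f b ↔ a ≤ b :=
    ⟨fun h => sdiff_eq_bot_iff.1 (hker _ (by rw [map_sdiff']; exact sdiff_eq_bot_iff.2 h)),
      fun h => OrderHomClass.mono f h⟩
  RelIso.ofSurjective (OrderEmbedding.ofMapLEIff f fun _ _ => hle) hf

theorem IsPosetAlgebra.exists_ult_le_mk_inter {B : Type u} [BooleanAlgebra B]
    (hB : IsPosetAlgebra B) {κ : Cardinal.{u}} (hκ : κ.IsRegular) (hκ' : ℵ₀ < κ) (hκB : κ ≤ #B)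
    {G : Set B} (hG : GeneratesBA G) : ∃ p ∈ Ult B, κ ≤ #(G ∩ (p : Set B) : Set B) := by
  obtain ⟨P, _, ⟨i⟩⟩ := hB
  let π : BoundedLatticeHom (FreeBoolAlg P) B :=
    (i.symm : BoundedLatticeHom _ _).comp (PosetAlgebra.mk P)
  have hπ : Function.Surjective π := i.symm.surjective.comp PosetAlgebra.mk_surjective
  have he : GeneratesBA (Set.range fun p : P => π (FreeBoolAlg.of p)) := by
    convert (FreeBoolAlg.generatesBA_range_of P).image π hπ using 1
    exact Set.range_comp π FreeBoolAlg.of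
  -- Taking `upperClosure` makes evaluation kill `I_P` for every `x`, and changes nothing at upper
  -- sets.
  let ψ (x : Set P) : BoundedLatticeHom (PosetAlgebra P) Prop :=
    PosetAlgebra.lift (FreeBoolAlg.eval (upperClosure x : Set P))
      fun p q hpq => (upperClosure x).upper hpq
  let φ (x : Set P) : BoundedLatticeHom B Prop := (ψ x).comp (i : BoundedLatticeHom _ _)
  refine _root_.exists_ult_le_mk_inter he φ (fun x hx p => ?_) hκ hκ' hκB hG
  change ψ x (i (i.symm _)) ↔ _
  rw [i.apply_symm_apply]
  change p ∈ (upperClosure x : Set P) ↔ _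
  rw [hx.upperClosure]

/-! ### Interval algebras as poset algebras -/

section IntervalAlgebra

variable (C : Type u) [LinearOrder C]

/-- The non-minimal elements of a chain, in reverse order. -/
abbrev NonMinDual : Type u := {c : C // ¬ IsMin c}ᵒᵈ

/-- The value of a free generator is the corresponding final ray. -/
def IntervalAlgebra.ofFree :
    BoundedLatticeHom (FreeBoolAlg (NonMinDual C)) (IntervalAlgebra C) :=
  let r : C → Set (NonMinDual C) := fun c => {p | (OrderDual.ofDual p).1 ≤ c}
  have hr (t : FreeBoolAlg (NonMinDual C)) :
      r ⁻¹' t.1 ∈ BooleanSubalgebra.closure (Set.range fun a : C => Set.Ici a) :=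
    (FreeBoolAlg.generatesBA_range_of _).induction
      (C := fun t => r ⁻¹' t.1 ∈ BooleanSubalgebra.closure (Set.range fun a : C => Set.Ici a))
      (by
        rintro _ ⟨p, rfl⟩
        exact BooleanSubalgebra.subset_closure ⟨(OrderDual.ofDual p).1, rfl⟩)
      BooleanSubalgebra.bot_mem (fun _ _ h h' => BooleanSubalgebra.sup_mem h h')
      (fun _ h => BooleanSubalgebra.compl_mem h) t
  { toFun t := ⟨r ⁻¹' t.1, hr t⟩
    map_sup' _ _ := rfl
    map_inf' _ _ := rfl
    map_top' := rfl
    map_bot' := rfl }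

theorem IntervalAlgebra.mem_ofFree {t : FreeBoolAlg (NonMinDual C)} {c : C} :
    c ∈ (ofFree C t).1 ↔ {p : NonMinDual C | (OrderDual.ofDual p).1 ≤ c} ∈ t.1 := Iff.rfl

theorem IntervalAlgebra.ofFree_surjective : Function.Surjective (ofFree C) := by
  refine (generatesBA_closure (Set.range fun a : C => Set.Ici a)).induction
    ?_ ⟨⊥, map_bot _⟩ ?_ ?_
  · rintro ⟨_, _⟩ ⟨a, rfl⟩
    -- The ray of a least point is all of `C`, so it needs no generator.
    by_cases ha : IsMin a
    · refine ⟨⊤, Subtype.ext (Set.ext fun c => ?_)⟩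
      simpa using (le_total a c).elim id fun h => ha h
    · exact ⟨FreeBoolAlg.of (OrderDual.toDual ⟨a, ha⟩), rfl⟩
  · rintro _ _ ⟨s, rfl⟩ ⟨t, rfl⟩
    exact ⟨s ⊔ t, map_sup _ _ _⟩
  · rintro _ ⟨s, rfl⟩
    exact ⟨sᶜ, map_compl' _ _⟩

/-- On finitely many non-minimal elements, every initial segment looks like a principal one. -/
theorem exists_forall_mem_iff_le [Nonempty C] {x : Set (NonMinDual C)} (hx : IsUpperSet x)
    (F : Finset (NonMinDual C)) :
    ∃ c : C, ∀ p ∈ F, p ∈ x ↔ (OrderDual.ofDual p).1 ≤ c := by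
  classical
  by_cases hne : ({p ∈ F | p ∈ x} : Finset _).Nonempty
  · obtain ⟨m, hm, hmax⟩ := Finset.exists_max_image _
      (fun p : NonMinDual C => (OrderDual.ofDual p).1) hne
    rw [Finset.mem_filter] at hm
    exact ⟨(OrderDual.ofDual m).1, fun p hp =>
      ⟨fun h => hmax p (Finset.mem_filter.2 ⟨hp, h⟩), fun h => hx (a := m) h hm.2⟩⟩
  · have hF (p) (hp : p ∈ F) : p ∉ x := fun h => hne ⟨p, Finset.mem_filter.2 ⟨hp, h⟩⟩
    rcases F.eq_empty_or_nonempty with rfl | hFne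
    · exact ⟨Classical.arbitrary C, by simp⟩
    · obtain ⟨m, -, hmin⟩ := Finset.exists_min_image F
        (fun p : NonMinDual C => (OrderDual.ofDual p).1) hFne
      -- Here `x` misses `F`, so a point strictly below all of `F` is needed; nonminimality supplies
      -- it.
      obtain ⟨c, hc⟩ := not_isMin_iff.1 (OrderDual.ofDual m).2
      exact ⟨c, fun p hp => iff_of_false (hF p hp) (hc.trans_le (hmin p hp)).not_ge⟩

/-- The kernel is trivial: a nonzero element contains an upper set `x`, its finite support cannot
tell `x` from the segment below some `c`, and so its image contains `c`. -/
theorem isPosetAlgebra_intervalAlgebra [Nonempty C] : IsPosetAlgebra (IntervalAlgebra C) := by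
  have hmono (p q : NonMinDual C) (hpq : p ≤ q) :
      IntervalAlgebra.ofFree C (FreeBoolAlg.of p) ≤ IntervalAlgebra.ofFree C (FreeBoolAlg.of q) :=
    fun c (hc : (OrderDual.ofDual p).1 ≤ c) =>
      (show (OrderDual.ofDual q).1 ≤ (OrderDual.ofDual p).1 from hpq).trans hc
  refine ⟨NonMinDual C, inferInstance,
    ⟨((PosetAlgebra.lift _ hmono).orderIsoOfSurjective ?_ ?_).symm⟩⟩
  · exact Function.Surjective.of_comp (g := PosetAlgebra.mk _)
      (IntervalAlgebra.ofFree_surjective C)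
  · intro b hb
    obtain ⟨t, rfl⟩ := PosetAlgebra.mk_surjective b
    rw [PosetAlgebra.lift_mk] at hb
    refine PosetAlgebra.mk_eq_bot fun x hx hxt => ?_
    obtain ⟨F, hF⟩ := (FreeBoolAlg.generatesBA_range_of _).exists_finset t
    obtain ⟨c, hc⟩ := exists_forall_mem_iff_le C hx F
    have hct : c ∈ (IntervalAlgebra.ofFree C t).1 := by
      rw [IntervalAlgebra.mem_ofFree]
      exact (hF (FreeBoolAlg.eval x) (FreeBoolAlg.eval _) hc).1 hxt
    rw [hb] at hct
    exact hct

end IntervalAlgebra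

/-! ### Consequences and the main theorem -/

theorem IsPosetAlgebra.not_isCorsonBA {B : Type u} [BooleanAlgebra B]
    (hB : IsPosetAlgebra B) {κ : Cardinal.{u}} (hκ : κ.IsRegular) (hκ' : ℵ₀ < κ)
    (hκB : κ ≤ #B) : ¬ IsCorsonBA B κ := by
  rintro ⟨G, hG, hlt⟩
  obtain ⟨p, hp, hle⟩ := hB.exists_ult_le_mk_inter hκ hκ' hκB hG
  exact (hlt p hp).not_ge hle

theorem IsPosetAlgebra.ultrafilterSelectionProperty {B : Type u} [BooleanAlgebra B]
    (hB : IsPosetAlgebra B) (hreg : (#B).IsRegular) (hlt : ℵ₀ < #B) :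
    UltrafilterSelectionProperty B := by
  refine ⟨infinite_iff.2 hlt.le, fun G hG => ?_⟩
  obtain ⟨p, hp, hle⟩ := hB.exists_ult_le_mk_inter hreg hlt le_rfl hG
  exact ⟨p, hp, (mk_set_le _).antisymm hle⟩

theorem mainTheorem7 :
    (∀ (B : Type u) [BooleanAlgebra B], IsPosetAlgebra B →
      (∀ κ : Cardinal.{u}, κ.IsRegular → ℵ₀ < κ → κ ≤ #B →
        (∀ G : Set B, GeneratesBA G → ∃ p ∈ Ult B, κ ≤ #(G ∩ (p : Set B) : Set B)) ∧
        ¬ IsCorsonBA B κ) ∧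
      ((#B).IsRegular → ℵ₀ < #B →
        UltrafilterSelectionProperty B ∧ ¬ IsCorsonBA B #B)) ∧
    (∀ (C : Type u) [LinearOrder C],
      (Nonempty C → IsPosetAlgebra (IntervalAlgebra C)) ∧
      ((#(IntervalAlgebra C)).IsRegular → ℵ₀ < #(IntervalAlgebra C) →
        UltrafilterSelectionProperty (IntervalAlgebra C))) := by
  refine ⟨fun B _ hB => ⟨fun κ hκ hκ' hκB => ⟨fun G hG => hB.exists_ult_le_mk_inter hκ hκ' hκB hG,
    hB.not_isCorsonBA hκ hκ' hκB⟩, fun hreg hlt => ⟨hB.ultrafilterSelectionProperty hreg hlt,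
    hB.not_isCorsonBA hreg hlt le_rfl⟩⟩, fun C _ => ⟨fun _ => isPosetAlgebra_intervalAlgebra C,
    fun hreg hlt => ?_⟩⟩
  -- The interval algebra of the empty chain is finite.
  have : Nonempty C := by
    by_contra h
    rw [not_nonempty_iff] at h
    exact hlt.not_gt (mk_lt_aleph0)
  exact (isPosetAlgebra_intervalAlgebra C).ultrafilterSelectionProperty hreg hlt
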